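/- For a finite set $\mathcal F\subset\mathbb Z^m$ and $\theta,y\in\mathbb R^m$ let $$h_\theta(y)=\log\Big(\sum_{\alpha\in\mathcal F}e^{\langle\alpha-\theta,y\rangle}\Big),\qquad g(\theta)=\inf_{y\in\mathbb R^m}h_\theta(y)$$ be the objective function and the optimal value of the dual of the maximum entropy program on $\mathcal F$ with mean $\theta$. Let $\|\cdot\|$ be the Euclidean norm and $B(0,r)=\{y\in\mathbb R^m:\|y\|\le r\}$ (empty if $r<0$). There is an absolute constant $C>0$ such that for every polynomial $R\in\mathbb R[s,t]$ there exist an integer $m\ge 1$, a number $\varepsilon\in(0,1)$ and a finite set $\mathcal F\subset\mathbb Z^m$ with $\|\alpha\|\le C\,m^{3/2}$ for all $\alpha\in\mathcal F$, and a point $\theta\in\mathrm{conv}(\mathcal F)$, such that every $y\in B\big(0,R(m,\log\tfrac1\varepsilon)\big)$ satisfies $$h_\theta(y)>g(\theta)+\varepsilon.$$ -/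

import Mathlib

/-- The integer point `α ∈ ℤ^m`, seen in Euclidean space `ℝ^m` (with the `ℓ₂` norm). -/
noncomputable def intPoint {m : ℕ} (α : Fin m → ℤ) : EuclideanSpace ℝ (Fin m) :=
  WithLp.toLp 2 (fun i => (α i : ℝ))

/-- The marginal polytope `conv(F) ⊆ ℝ^m` of a finite set `F ⊆ ℤ^m`. -/
noncomputable def marginalPolytope {m : ℕ} (F : Finset (Fin m → ℤ)) :
    Set (EuclideanSpace ℝ (Fin m)) :=
  convexHull ℝ (intPoint '' (F : Set (Fin m → ℤ)))

/-- The objective function of the dual of the max-entropy program (uniform prior),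
`h_θ(y) = log (∑_{α ∈ F} exp ⟨α - θ, y⟩)`. -/
noncomputable def dualObjective {m : ℕ} (F : Finset (Fin m → ℤ))
    (θ y : EuclideanSpace ℝ (Fin m)) : ℝ :=
  Real.log (∑ α ∈ F, Real.exp (inner ℝ (intPoint α - θ) y))

/-- The optimal value `g(θ) = inf_{y ∈ ℝ^m} h_θ(y)` of the dual program. For `θ ∈ conv(F)` the
function `h_θ` is nonnegative, so this is a genuine infimum. -/
noncomputable def dualValue {m : ℕ} (F : Finset (Fin m → ℤ))
    (θ : EuclideanSpace ℝ (Fin m)) : ℝ :=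
  ⨅ y : EuclideanSpace ℝ (Fin m), dualObjective F θ y

/-! Take `θ = 0`, itself a point of the support, and fix `ε = 1/4`, so that only the dimension `m =
n + 1` varies. The dual value is at most `0`, approached along `chainDual n t` as `t → ∞`. A
`1/4`-optimal `y` must pair to at most `-1` with every chain vector, so `y₀ ≤ -1` and `y_{j+1} ≤ 3
y_j - 1`; hence `‖y‖ ≥ 3 ^ n` (`three_pow_le_norm`), which outgrows any polynomial in `m`. -/

/-- The vectors `e₀` and `e_{j+1} - 3 e_j` of `ℤ^{n+1}`. Any `y` with negative pairing against all of
them has coordinates growing geometrically. -/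
def chainVector (n : ℕ) : Fin (n + 1) → Fin (n + 1) → ℤ :=
  Fin.cases (Pi.single 0 1) fun j => Pi.single j.succ 1 - Pi.single j.castSucc 3

lemma inner_intPoint {m : ℕ} (α : Fin m → ℤ) (y : EuclideanSpace ℝ (Fin m)) :
    inner ℝ (intPoint α) y = ∑ i, (α i : ℝ) * y i := by
  simp [intPoint, PiLp.inner_apply, mul_comm]

lemma intPoint_zero {m : ℕ} : intPoint (0 : Fin m → ℤ) = 0 := by
  ext i
  simp [intPoint]

lemma intPoint_single {m : ℕ} (i : Fin m) (a : ℤ) :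
    intPoint (Pi.single i a) = EuclideanSpace.single i (a : ℝ) := by
  ext k
  by_cases h : k = i
  · subst h
    simp [intPoint]
  · simp [intPoint, h]

lemma intPoint_sub {m : ℕ} (α β : Fin m → ℤ) :
    intPoint (α - β) = intPoint α - intPoint β := by
  ext k
  simp [intPoint]

lemma inner_chainVector_zero (n : ℕ) (y : EuclideanSpace ℝ (Fin (n + 1))) :
    inner ℝ (intPoint (chainVector n 0)) y = y 0 := by
  simp [chainVector, intPoint_single, EuclideanSpace.inner_single_left]

lemma inner_chainVector_succ (n : ℕ) (j : Fin n) (y : EuclideanSpace ℝ (Fin (n + 1))) :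
    inner ℝ (intPoint (chainVector n j.succ)) y = y j.succ - 3 * y j.castSucc := by
  simp [chainVector, intPoint_sub, intPoint_single, inner_sub_left,
    EuclideanSpace.inner_single_left]

lemma norm_chainVector_le (n : ℕ) (i : Fin (n + 1)) : ‖intPoint (chainVector n i)‖ ≤ 4 := by
  refine Fin.cases ?_ (fun j => ?_) i
  · simp [chainVector, intPoint_single]
  · simp only [chainVector, Fin.cases_succ, intPoint_sub, intPoint_single]
    refine (norm_sub_le _ _).trans ?_
    simp
    norm_num

lemma chainVector_ne_zero (n : ℕ) (i : Fin (n + 1)) : chainVector n i ≠ 0 := by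
  intro h
  have h' := congrFun h i
  revert h'
  refine Fin.cases ?_ (fun j => ?_) i
  · simp [chainVector]
  · simp [chainVector, (Fin.castSucc_lt_succ (i := j)).ne']

/-- The origin together with all `chainVector`s. -/
def chainSupport (n : ℕ) : Finset (Fin (n + 1) → ℤ) :=
  insert 0 (Finset.univ.image (chainVector n))

/-- The descending direction `y_k = -t (1 + 3 + ⋯ + 3^k)`, pairing to `-t` with each
`chainVector`. -/
noncomputable def chainDual (n : ℕ) (t : ℝ) : EuclideanSpace ℝ (Fin (n + 1)) :=
  WithLp.toLp 2 fun k => -t * ((3 ^ ((k : ℕ) + 1) - 1) / 2)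

lemma inner_chainVector_chainDual (n : ℕ) (t : ℝ) (i : Fin (n + 1)) :
    inner ℝ (intPoint (chainVector n i)) (chainDual n t) = -t := by
  refine Fin.cases ?_ (fun j => ?_) i
  · rw [inner_chainVector_zero]
    simp [chainDual]
    norm_num
  · rw [inner_chainVector_succ]
    simp [chainDual]
    ring

lemma apply_le_of_inner_chainVector_le (n : ℕ) (y : EuclideanSpace ℝ (Fin (n + 1)))
    (h : ∀ i, inner ℝ (intPoint (chainVector n i)) y ≤ -1) (i : Fin (n + 1)) :
    y i ≤ -3 ^ (i : ℕ) := by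
  induction i using Fin.induction with
  | zero => simpa [inner_chainVector_zero] using h 0
  | succ j ih =>
    have := h j.succ
    rw [inner_chainVector_succ] at this
    simp only [Fin.val_castSucc, Fin.val_succ, pow_succ] at ih ⊢
    linarith

lemma dualObjective_zero_nonneg {m : ℕ} {F : Finset (Fin m → ℤ)} (h : 0 ∈ F)
    (y : EuclideanSpace ℝ (Fin m)) : 0 ≤ dualObjective F 0 y := by
  refine Real.log_nonneg ?_
  have := Finset.single_le_sum
    (f := fun α => Real.exp (inner ℝ (intPoint α - 0) y)) (fun _ _ => (Real.exp_pos _).le) h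
  simpa [intPoint_zero] using this

lemma dualObjective_chainDual_le (n : ℕ) (t : ℝ) :
    dualObjective (chainSupport n) 0 (chainDual n t) ≤ (n + 1) * Real.exp (-t) := by
  have h0 : (0 : Fin (n + 1) → ℤ) ∉ Finset.univ.image (chainVector n) := by
    simpa using chainVector_ne_zero n
  have hsum : ∑ α ∈ Finset.univ.image (chainVector n),
      Real.exp (inner ℝ (intPoint α) (chainDual n t)) ≤ (n + 1) * Real.exp (-t) := by
    rw [Finset.sum_congr rfl (g := fun _ => Real.exp (-t))]
    · rw [Finset.sum_const, nsmul_eq_mul]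
      gcongr
      exact_mod_cast Finset.card_image_le.trans (by simp)
    · simp [inner_chainVector_chainDual]
  have hpos : 0 ≤ ∑ α ∈ Finset.univ.image (chainVector n),
      Real.exp (inner ℝ (intPoint α) (chainDual n t)) :=
    Finset.sum_nonneg fun _ _ => (Real.exp_pos _).le
  simp only [dualObjective, chainSupport, sub_zero, Finset.sum_insert h0, intPoint_zero,
    inner_zero_left, Real.exp_zero]
  refine (Real.log_le_sub_one_of_pos (by linarith)).trans ?_
  linarith

lemma dualValue_chainSupport_le (n : ℕ) : dualValue (chainSupport n) 0 ≤ 0 := by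
  refine le_of_forall_pos_le_add fun δ hδ => ?_
  have hbdd : BddBelow (Set.range (dualObjective (chainSupport n) 0)) :=
    ⟨0, by
      rintro _ ⟨y, rfl⟩
      exact dualObjective_zero_nonneg (Finset.mem_insert_self _ _) y⟩
  -- This `t` makes `(n + 1) * exp (-t)` equal to `δ`.
  refine (ciInf_le hbdd (chainDual n (-Real.log (δ / (n + 1))))).trans ?_
  refine (dualObjective_chainDual_le n _).trans ?_
  rw [neg_neg, Real.exp_log (by positivity)]
  field_simp
  simp

lemma inner_chainVector_le_of_dualObjective_le (n : ℕ) (y : EuclideanSpace ℝ (Fin (n + 1)))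
    (h : dualObjective (chainSupport n) 0 y ≤ 1 / 4) (i : Fin (n + 1)) :
    inner ℝ (intPoint (chainVector n i)) y ≤ -1 := by
  have hsub : ({0, chainVector n i} : Finset (Fin (n + 1) → ℤ)) ⊆ chainSupport n := by
    simp [chainSupport, Finset.insert_subset_iff]
  have hle := Finset.sum_le_sum_of_subset_of_nonneg
    (f := fun α => Real.exp (inner ℝ (intPoint α - 0) y)) hsub
    (fun _ _ _ => (Real.exp_pos _).le)
  rw [Finset.sum_pair (chainVector_ne_zero n i).symm] at hle
  simp only [sub_zero, intPoint_zero, inner_zero_left, Real.exp_zero] at hle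
  have hpos : 0 < ∑ α ∈ chainSupport n, Real.exp (inner ℝ (intPoint α) y) :=
    lt_of_lt_of_le (by positivity) hle
  simp only [dualObjective, sub_zero] at h
  rw [Real.log_le_iff_le_exp hpos] at h
  -- With `0` contributing `1` to the sum, each other term is at most `e^{1/4} - 1 ≤ 0.3 < 0.36 ≤
  -- e⁻¹`.
  have hquarter : Real.exp (1 / 4) ≤ 1.3 := by
    refine le_of_pow_le_pow_left₀ (n := 4) (by norm_num) (by norm_num) ?_
    rw [← Real.exp_nat_mul]
    have := Real.exp_one_lt_d9
    norm_num at this ⊢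
    linarith
  have hinv : 0.36 ≤ Real.exp (-1) := by
    have := Real.exp_neg_one_gt_d9
    linarith
  exact Real.exp_le_exp.1 (by linarith)

lemma three_pow_le_norm (n : ℕ) (y : EuclideanSpace ℝ (Fin (n + 1)))
    (h : dualObjective (chainSupport n) 0 y ≤ 1 / 4) : 3 ^ n ≤ ‖y‖ := by
  have hlast := apply_le_of_inner_chainVector_le n y
    (inner_chainVector_le_of_dualObjective_le n y h) (Fin.last n)
  rw [Fin.val_last] at hlast
  calc (3 : ℝ) ^ n ≤ -y (Fin.last n) := by linarith
    _ ≤ ‖y (Fin.last n)‖ := neg_le_abs _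
    _ ≤ ‖y‖ := PiLp.norm_apply_le y _

/-- A bivariate polynomial with its second variable fixed is eventually dominated by `3 ^ n`. -/
lemma exists_eval_lt_three_pow (R : MvPolynomial (Fin 2) ℝ) (c : ℝ) :
    ∃ n : ℕ, MvPolynomial.eval ![((n + 1 : ℕ) : ℝ), c] R < 3 ^ n := by
  let p : Polynomial ℝ := MvPolynomial.aeval ![Polynomial.X, Polynomial.C c] R
  have hp : ∀ x : ℝ, p.eval x = MvPolynomial.eval ![x, c] R := by
    intro x
    have h : ((Polynomial.aeval x).comp
        (MvPolynomial.aeval ![Polynomial.X, Polynomial.C c])) =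
        MvPolynomial.aeval (R := ℝ) ![x, c] := by
      ext i
      fin_cases i <;> simp
    have := DFunLike.congr_fun h R
    simpa [p, Polynomial.coe_aeval_eq_eval, MvPolynomial.aeval_eq_eval] using this
  have hlim := (Polynomial.tendsto_div_exp_atTop p).comp
    (tendsto_natCast_atTop_atTop.comp (Filter.tendsto_add_atTop_nat 1))
  -- The factor `1/3` absorbs the shift from `m = n + 1` to `n`: `e ^ (n + 1) / 3 ≤ 3 ^ n`, as `e <
  -- 3`.
  obtain ⟨n, hn⟩ := (hlim.eventually_lt_const (show (0 : ℝ) < 1 / 3 by norm_num)).exists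
  refine ⟨n, ?_⟩
  simp only [Function.comp_apply, hp] at hn
  rw [div_lt_iff₀ (Real.exp_pos _)] at hn
  have hexp : Real.exp ((n + 1 : ℕ) : ℝ) ≤ 3 ^ (n + 1) := by
    rw [← mul_one ((n + 1 : ℕ) : ℝ), Real.exp_nat_mul]
    gcongr
    exact Real.exp_one_lt_d9.le.trans (by norm_num)
  rw [pow_succ] at hexp
  linarith

theorem theorem2p3 :
    ∃ C : ℝ, 0 < C ∧
      ∀ R : MvPolynomial (Fin 2) ℝ,
        ∃ (m : ℕ) (ε : ℝ) (F : Finset (Fin m → ℤ)),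
          1 ≤ m ∧ 0 < ε ∧ ε < 1 ∧
          (∀ α ∈ F, ‖intPoint α‖ ≤ C * (m : ℝ) ^ (3 / 2 : ℝ)) ∧
          ∃ θ ∈ marginalPolytope F,
            ∀ y ∈ Metric.closedBall (0 : EuclideanSpace ℝ (Fin m))
                (MvPolynomial.eval ![(m : ℝ), Real.log (1 / ε)] R),
              dualObjective F θ y > dualValue F θ + ε := by
  refine ⟨4, by norm_num, fun R => ?_⟩
  obtain ⟨n, hn⟩ := exists_eval_lt_three_pow R (Real.log (1 / (1 / 4)))
  refine ⟨n + 1, 1 / 4, chainSupport n, by omega, by norm_num, by norm_num, ?_, 0, ?_, ?_⟩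
  · intro α hα
    have hα4 : ‖intPoint α‖ ≤ 4 := by
      rcases Finset.mem_insert.1 hα with rfl | hα
      · simp [intPoint_zero]
      · obtain ⟨i, -, rfl⟩ := Finset.mem_image.1 hα
        exact norm_chainVector_le n i
    have hm : (1 : ℝ) ≤ ((n + 1 : ℕ) : ℝ) ^ (3 / 2 : ℝ) :=
      Real.one_le_rpow (by simp) (by norm_num)
    linarith
  · exact subset_convexHull ℝ _ ⟨0, by simp [chainSupport], intPoint_zero⟩
  · intro y hy
    by_contra! h
    have hnorm := three_pow_le_norm n y (by linarith [dualValue_chainSupport_le n])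
    rw [mem_closedBall_zero_iff] at hy
    linarith
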